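/- Let $\mathsf{IST}$ be Nelson's internal set theory: the first-order theory, in the language with equality, the binary symbol $\in$ and the unary symbol $\mathrm{st}$ ("standard"), whose axioms are those of $\mathsf{ZFC}$ (with Separation and Replacement only for $\in$-formulas) together with the following three schemes, in which $\forall^{\mathrm{st}}$, $\exists^{\mathrm{st}}$ are quantifiers restricted to standard sets. - Idealization: $\forall^{\mathrm{st}}\text{ finite }A\ \exists x\ \forall a\in A\ \varphi(x,a)\leftrightarrow\exists x\ \forall^{\mathrm{st}}a\ \varphi(x,a)$, for every $\in$-formula $\varphi$ with arbitrary parameters. - Standardization: $\forall^{\mathrm{st}}X\ \exists^{\mathrm{st}}Y\ \forall^{\mathrm{st}}x\ [x\in Y\leftrightarrow x\in X\wedge\varphi(x)]$, for every formula $\varphi$ of the full language with arbitrary parameters. - Transfer: $\exists x\,\varphi(x)\to\exists^{\mathrm{st}}x\,\varphi(x)$, for every $\in$-formula $\varphi$ with standard parameters. Let $(*)$ be the sentence $$\forall F\,\bigl[\forall^{\mathrm{st}}n\,(F(n)\text{ is standard})\to\exists^{\mathrm{st}}G\ \forall^{\mathrm{st}}n\,(F(n)=G(n))\bigr],$$ where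 $n$ ranges over the natural numbers, and $F$ and $G$ over functions whose domain is the set $\omega$ of all natural numbers and whose values are arbitrary sets. **Theorem 1.** Suppose that $\mathsf{IST}$ is consistent. Then for no sentence $\Phi$ of the language of $\mathsf{ZFC}$ is the equivalence $\Phi\leftrightarrow(*)$ a theorem of $\mathsf{IST}$. Consequently, there is no map, algorithmic or not, that assigns to every sentence $\sigma$ of the language of $\mathsf{IST}$ a sentence $R(\sigma)$ of the language of $\mathsf{ZFC}$ such that $R(\sigma)\leftrightarrow\sigma$ is a theorem of $\mathsf{IST}$; in particular, Nelson's reduction algorithm, which does this for bounded formulas, cannot be extended to all formulas of the language of $\mathsf{IST}$. -/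

import Mathlib

open scoped FirstOrder

namespace InternalSetTheory

open FirstOrder FirstOrder.Language

universe u v

section Calculus

variable {L : FirstOrder.Language.{u, v}}

/-- `φ[t]`: replace the outermost variable `&0` of `φ` by the term `t`
(free variables are named by natural numbers). -/
def instTerm (φ : L.BoundedFormula ℕ 1) (t : L.Term ℕ) : L.Formula ℕ :=
  φ.toFormula.subst (Sum.elim Term.var (fun _ => t))

/-- Rename every free variable `k` to `k + 1`, so that the variable `0` becomes fresh. -/
def shift (φ : L.Formula ℕ) : L.Formula ℕ :=
  Formula.relabel (fun k => k + 1) φ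

/-- The body `φ` of a quantifier, with the free variables shifted and the fresh variable `0`
in place of the variable `&0`. -/
def openFresh (φ : L.BoundedFormula ℕ 1) : L.Formula ℕ :=
  Formula.relabel (Sum.elim (fun k => k + 1) (fun _ => 0)) φ.toFormula

/-- Classical natural deduction for first-order logic with equality, on the primitive connectives
`⊥`, `⟹`, `∀'` and `=`.  `Derives Γ φ` says that `φ` has a formal derivation from the
hypotheses `Γ`. -/
inductive Derives : Set (L.Formula ℕ) → L.Formula ℕ → Prop
  | hyp {Γ : Set (L.Formula ℕ)} {φ : L.Formula ℕ} : φ ∈ Γ → Derives Γ φ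
  | impIntro {Γ : Set (L.Formula ℕ)} {φ ψ : L.Formula ℕ} :
      Derives (insert φ Γ) ψ → Derives Γ (φ.imp ψ)
  | impElim {Γ : Set (L.Formula ℕ)} {φ ψ : L.Formula ℕ} :
      Derives Γ (φ.imp ψ) → Derives Γ φ → Derives Γ ψ
  | byContra {Γ : Set (L.Formula ℕ)} {φ : L.Formula ℕ} :
      Derives (insert (φ.imp ⊥) Γ) ⊥ → Derives Γ φ
  | allIntro {Γ : Set (L.Formula ℕ)} {φ : L.BoundedFormula ℕ 1} :
      Derives (shift '' Γ) (openFresh φ) → Derives Γ φ.all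
  | allElim {Γ : Set (L.Formula ℕ)} {φ : L.BoundedFormula ℕ 1} (t : L.Term ℕ) :
      Derives Γ φ.all → Derives Γ (instTerm φ t)
  | eqRefl {Γ : Set (L.Formula ℕ)} (t : L.Term ℕ) : Derives Γ (t.equal t)
  | eqSubst {Γ : Set (L.Formula ℕ)} (φ : L.BoundedFormula ℕ 1) {s t : L.Term ℕ} :
      Derives Γ (s.equal t) → Derives Γ (instTerm φ s) → Derives Γ (instTerm φ t)

/-- A sentence, seen as a formula of the calculus. -/
def ofSentence (σ : L.Sentence) : L.Formula ℕ :=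
  Formula.relabel Empty.elim σ

/-- `σ` is a theorem of the theory `T`: it is formally derivable from the axioms in `T`. -/
def IsTheorem (T : L.Theory) (σ : L.Sentence) : Prop :=
  Derives (ofSentence '' T) (ofSentence σ)

/-- `T` does not derive a contradiction. -/
def IsConsistent (T : L.Theory) : Prop :=
  ¬ IsTheorem T ⊥

/-- Rename the variables `&0, …, &(k-1)` of `φ` to `&(v 0), …, &(v (k-1))`. -/
def ren {α : Type*} {k l : ℕ} (v : Fin k → Fin l) (φ : L.BoundedFormula α k) :
    L.BoundedFormula α l :=
  BoundedFormula.relabel (k := 0) (Sum.elim Sum.inl (fun i => Sum.inr (v i))) φ.toFormula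

/-- The universal closure of a formula whose free variables are indexed by `Fin n`. -/
def univClosure {n : ℕ} (φ : L.Formula (Fin n)) : L.Sentence :=
  BoundedFormula.alls (BoundedFormula.relabel (k := 0) (n := n) Sum.inr φ)

end Calculus

/-! ### The languages -/

/-- The membership symbol. -/
inductive MemRel : ℕ → Type
  | mem : MemRel 2

/-- The language of ZFC. -/
def LMem : FirstOrder.Language.{0, 0} := ⟨fun _ => Empty, MemRel⟩

/-- The membership symbol and the standardness symbol. -/
inductive StRel : ℕ → Type
  | mem : StRel 2
  | st : StRel 1

/-- The language of internal set theory. -/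
def LSt : FirstOrder.Language.{0, 0} := ⟨fun _ => Empty, StRel⟩

/-- The inclusion of the language of ZFC in the language of internal set theory. -/
def incl : LMem →ᴸ LSt where
  onFunction := fun _ f => f
  onRelation := fun _ R => match R with
    | MemRel.mem => StRel.mem

/-- An `∈`-formula, seen as a formula of the language of internal set theory. -/
def internal {α : Type*} {n : ℕ} (φ : LMem.BoundedFormula α n) : LSt.BoundedFormula α n :=
  incl.onBoundedFormula φ

variable {α : Type*} {n : ℕ}

/-- `s ∈ t` in the language of ZFC. -/
def memF (s t : LMem.Term (α ⊕ Fin n)) : LMem.BoundedFormula α n :=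
  Relations.boundedFormula₂ (L := LMem) MemRel.mem s t

/-- `s ∈ t` in the language of internal set theory. -/
def memS (s t : LSt.Term (α ⊕ Fin n)) : LSt.BoundedFormula α n :=
  Relations.boundedFormula₂ (L := LSt) StRel.mem s t

/-- `t` is standard. -/
def stS (t : LSt.Term (α ⊕ Fin n)) : LSt.BoundedFormula α n :=
  Relations.boundedFormula₁ (L := LSt) StRel.st t

local infix:88 " ∈ᶠ " => memF
local infix:88 " ∈ˢ " => memS

/-- `∀ˢᵗ x, φ`, where `x` is the last variable of `φ`. -/
def allSt (φ : LSt.BoundedFormula α (n + 1)) : LSt.BoundedFormula α n :=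
  ∀' (stS (Term.var (Sum.inr (Fin.last n))) ⟹ φ)

/-- `∃ˢᵗ x, φ`, where `x` is the last variable of `φ`. -/
def exSt (φ : LSt.BoundedFormula α (n + 1)) : LSt.BoundedFormula α n :=
  ∃' (stS (Term.var (Sum.inr (Fin.last n))) ⊓ φ)

/-- `∀ˢᵗ x₀ … ∀ˢᵗ xₙ₋₁, φ`. -/
def allsSt : ∀ {n : ℕ}, LSt.BoundedFormula α n → LSt.Formula α
  | 0, φ => φ
  | _ + 1, φ => allsSt (allSt φ)

/-- The closure of a formula under universal quantifiers over the standard sets. -/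
def stClosure (φ : LSt.Formula (Fin n)) : LSt.Sentence :=
  allsSt (BoundedFormula.relabel (k := 0) (n := n) Sum.inr φ)

/-! ### ZFC -/

/-- Sets with the same elements are equal. -/
def extensionality : LMem.Sentence :=
  ∀' ∀' ((∀' (&2 ∈ᶠ &0 ⇔ &2 ∈ᶠ &1)) ⟹ &0 =' &1)

/-- Every nonempty set has an element disjoint from it. -/
def foundation : LMem.Sentence :=
  ∀' ((∃' (&1 ∈ᶠ &0)) ⟹ ∃' (&1 ∈ᶠ &0 ⊓ ∀' (&2 ∈ᶠ &0 ⟹ ∼(&2 ∈ᶠ &1))))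

/-- `{x, y}` exists. -/
def pairing : LMem.Sentence :=
  ∀' ∀' ∃' ∀' (&3 ∈ᶠ &2 ⇔ (&3 =' &0 ⊔ &3 =' &1))

/-- `⋃ x` exists. -/
def union : LMem.Sentence :=
  ∀' ∃' ∀' (&2 ∈ᶠ &1 ⇔ ∃' (&3 ∈ᶠ &0 ⊓ &2 ∈ᶠ &3))

/-- The power set of `x` exists. -/
def powerSet : LMem.Sentence :=
  ∀' ∃' ∀' (&2 ∈ᶠ &1 ⇔ ∀' (&3 ∈ᶠ &2 ⟹ &3 ∈ᶠ &0))

/-- `&0` contains the empty set and is closed under `y ↦ y ∪ {y}`. -/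
def inductiveF : LMem.BoundedFormula α 1 :=
  (∃' (&1 ∈ᶠ &0 ⊓ ∀' ∼(&2 ∈ᶠ &1))) ⊓
    ∀' (&1 ∈ᶠ &0 ⟹ ∃' (&2 ∈ᶠ &0 ⊓ ∀' (&3 ∈ᶠ &2 ⇔ (&3 ∈ᶠ &1 ⊔ &3 =' &1))))

/-- There is an inductive set. -/
def infinity : LMem.Sentence :=
  ∃' inductiveF

/-- For every set `x` of nonempty pairwise disjoint sets there is a set that meets each element of
`x` in exactly one point. -/
def choice : LMem.Sentence :=
  ∀' (((∀' (&1 ∈ᶠ &0 ⟹ ∃' (&2 ∈ᶠ &1))) ⊓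
        ∀' ∀' ((&1 ∈ᶠ &0 ⊓ &2 ∈ᶠ &0 ⊓ ∃' (&3 ∈ᶠ &1 ⊓ &3 ∈ᶠ &2)) ⟹ &1 =' &2)) ⟹
      ∃' ∀' (&2 ∈ᶠ &0 ⟹ ∃' ∀' ((&4 ∈ᶠ &2 ⊓ &4 ∈ᶠ &1) ⇔ &4 =' &3)))

/-- Separation for `φ(x)`, with parameters: `∀ X, ∃ Y, ∀ x, x ∈ Y ↔ x ∈ X ∧ φ(x)`. -/
def separation (φ : LMem.BoundedFormula (Fin n) 1) : LMem.Sentence :=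
  univClosure (∀' ∃' ∀' (&2 ∈ᶠ &1 ⇔ (&2 ∈ᶠ &0 ⊓ ren ![2] φ)))

/-- Replacement for `φ(x, y)`, with parameters: if `φ` is functional on `A`, then
the image of `A` under `φ` exists. -/
def replacement (φ : LMem.BoundedFormula (Fin n) 2) : LMem.Sentence :=
  univClosure
    (∀' ((∀' (&1 ∈ᶠ &0 ⟹ ∀' ∀' ((ren ![1, 2] φ ⊓ ren ![1, 3] φ) ⟹ &2 =' &3))) ⟹
      ∃' ∀' (&2 ∈ᶠ &1 ⇔ ∃' (&3 ∈ᶠ &0 ⊓ ren ![3, 2] φ))))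

/-- The axioms of Zermelo–Fraenkel set theory with choice. -/
inductive IsZFCAxiom : LMem.Sentence → Prop
  | extensionality : IsZFCAxiom extensionality
  | foundation : IsZFCAxiom foundation
  | pairing : IsZFCAxiom pairing
  | union : IsZFCAxiom union
  | powerSet : IsZFCAxiom powerSet
  | infinity : IsZFCAxiom infinity
  | choice : IsZFCAxiom choice
  | separation {n : ℕ} (φ : LMem.BoundedFormula (Fin n) 1) : IsZFCAxiom (separation φ)
  | replacement {n : ℕ} (φ : LMem.BoundedFormula (Fin n) 2) : IsZFCAxiom (replacement φ)

/-- The theory ZFC. -/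
def ZFC : LMem.Theory := {σ | IsZFCAxiom σ}

/-! ### Some notions of set theory, as `∈`-formulas -/

/-- `&0` is a natural number: it belongs to every inductive set. -/
def natF : LMem.BoundedFormula α 1 :=
  ∀' (ren ![1] inductiveF ⟹ &0 ∈ᶠ &1)

/-- `&0` is the ordered pair `(&1, &2) = {{&1}, {&1, &2}}`. -/
def pairF : LMem.BoundedFormula α 3 :=
  ∀' (&3 ∈ᶠ &0 ⇔
    ((∀' (&4 ∈ᶠ &3 ⇔ &4 =' &1)) ⊔ ∀' (&4 ∈ᶠ &3 ⇔ (&4 =' &1 ⊔ &4 =' &2))))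

/-- The pair `(&1, &2)` belongs to `&0`; for a function `&0` this says `&0(&1) = &2`. -/
def appF : LMem.BoundedFormula α 3 :=
  ∃' (&3 ∈ᶠ &0 ⊓ ren ![3, 1, 2] pairF)

/-- `&0` is a function, with domain `&1`: a set of pairs whose first components lie in `&1`, that
has exactly one value at every element of `&1`. -/
def funOnF : LMem.BoundedFormula α 2 :=
  (∀' (&2 ∈ᶠ &0 ⟹ ∃' ∃' (&3 ∈ᶠ &1 ⊓ ren ![2, 3, 4] pairF))) ⊓
    ∀' (&2 ∈ᶠ &1 ⟹ ∃' ∀' (ren ![0, 2, 4] appF ⇔ &4 =' &3))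

/-- `&0` is finite: there is a bijection of `&0` onto a natural number. -/
def finiteF : LMem.BoundedFormula α 1 :=
  ∃' ∃' (ren ![1] natF ⊓ ren ![2, 0] funOnF ⊓
    (∀' ∀' (ren ![2, 3, 4] appF ⟹ &4 ∈ᶠ &1)) ⊓
    ∀' (&3 ∈ᶠ &1 ⟹ ∃' ∀' (ren ![2, 5, 3] appF ⇔ &5 =' &4)))

/-- `&0` is the set of all natural numbers. -/
def omegaF : LMem.BoundedFormula α 1 :=
  ∀' (&1 ∈ᶠ &0 ⇔ ren ![1] natF)

/-- `&0` is a function whose domain is the set of all natural numbers. -/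
def funOnOmegaF : LMem.BoundedFormula α 1 :=
  ∃' (ren ![1] omegaF ⊓ ren ![0, 1] funOnF)

/-! ### Internal set theory -/

/-- Idealization for an `∈`-formula `φ(x, a)` with arbitrary parameters:
`(∀ˢᵗ finite A, ∃ x, ∀ a ∈ A, φ(x, a)) ↔ ∃ x, ∀ˢᵗ a, φ(x, a)`. -/
def idealization (φ : LMem.BoundedFormula (Fin n) 2) : LSt.Sentence :=
  univClosure
    ((allSt (internal finiteF ⟹ ∃' ∀' (&2 ∈ˢ &0 ⟹ internal (ren ![1, 2] φ)))) ⇔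
      ∃' allSt (internal φ))

/-- Standardization for an arbitrary formula `φ(x)` with arbitrary parameters:
`∀ˢᵗ X, ∃ˢᵗ Y, ∀ˢᵗ x, x ∈ Y ↔ x ∈ X ∧ φ(x)`. -/
def standardization (φ : LSt.BoundedFormula (Fin n) 1) : LSt.Sentence :=
  univClosure (allSt (exSt (allSt (&2 ∈ˢ &1 ⇔ (&2 ∈ˢ &0 ⊓ ren ![2] φ)))))

/-- Transfer for an `∈`-formula `φ(x)` with standard parameters: `(∃ x, φ(x)) → ∃ˢᵗ x, φ(x)`. -/
def transfer (φ : LMem.BoundedFormula (Fin n) 1) : LSt.Sentence :=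
  stClosure ((∃' (internal φ)) ⟹ exSt (internal φ))

/-- The axioms of internal set theory. -/
inductive IsISTAxiom : LSt.Sentence → Prop
  | zfc (σ : LMem.Sentence) : σ ∈ ZFC → IsISTAxiom (internal σ)
  | idealization {n : ℕ} (φ : LMem.BoundedFormula (Fin n) 2) : IsISTAxiom (idealization φ)
  | standardization {n : ℕ} (φ : LSt.BoundedFormula (Fin n) 1) : IsISTAxiom (standardization φ)
  | transfer {n : ℕ} (φ : LMem.BoundedFormula (Fin n) 1) : IsISTAxiom (transfer φ)

/-- Nelson's internal set theory. -/
def IST : LSt.Theory := {σ | IsISTAxiom σ}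

/-- The sentence `(∗)`: for every function `F` on the natural numbers, if `F(n)` is standard for all
standard `n`, then there is a standard function `G` on the natural numbers such that
`F(n) = G(n)` for all standard `n`. -/
def star : LSt.Sentence :=
  ∀' (internal funOnOmegaF ⟹
    (allSt (internal (ren ![1] natF) ⟹ exSt (internal (ren ![0, 1, 2] appF)))) ⟹
      exSt (internal (ren ![1] funOnOmegaF) ⊓
        allSt (internal (ren ![2] natF) ⟹
          ∃' (internal (ren ![0, 2, 3] appF) ⊓ internal (ren ![1, 2, 3] appF)))))

end InternalSetTheory

namespace InternalSetTheory

open FirstOrder FirstOrder.Language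

universe u v w

/-! Two models of `IST` are built that satisfy the same `∈`-sentences but disagree about `star`. By
soundness of the calculus (`Derives.sound`), no `∈`-sentence can then be provably equivalent to
`star`, and a reduction map would provide one for `star` itself.

Let `W` be an elementary submodel of the universe `ZFSet` that is closed under elements, subsets and
insertion. Let `j` embed `W` elementarily in an extension `M` in which every `∈`-type over the image
of `W`, with finitely many parameters from `M`, is realized once it is finitely satisfiable. Call
the elements of `j '' W` standard. Then `M` is a model of `IST` (`realize_IST`): ZFC and Transfer
come from elementarity, Idealization from saturation, and Standardization from the fact that `W`
contains every actual subset of its elements. Such an `M` is the limit of `ω` iterated ultrapowers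
of `W` (`exists_realize_limitPower`). Its `∈`-theory is always that of `ZFSet`.

The choice of `W` decides `star`. If `W` is the whole universe, every actual sequence of standard
sets is coded by a standard function, so `star` holds (`realize_star_of_top`). If `W` is some `V_λ`
with `λ` of cofinality `ω` (`exists_supertransitive_cofinal`), take a sequence of elements of `W`
with cofinal ranks: saturation yields a function in `M` extending it, but a standard function with
these values would have rank at least `λ` (`not_realize_star`). -/

theorem snoc_fin_zero {M : Type*} (xs : Fin 0 → M) (a : M) :
    (Fin.snoc xs a : Fin (0 + 1) → M) = fun _ => a := by
  funext i; fin_cases i; rfl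

/-! ### Soundness of natural deduction and semantics of renaming -/

section Semantics

variable {L : FirstOrder.Language.{u, v}} {M : Type*} [L.Structure M]

theorem realize_instTerm (φ : L.BoundedFormula ℕ 1) (t : L.Term ℕ) (v : ℕ → M) :
    (instTerm φ t).Realize v ↔ φ.Realize v (fun _ => t.realize v) := by
  rw [instTerm, Formula.Realize, BoundedFormula.realize_subst]
  have h : (fun a => Term.realize v (Sum.elim Term.var (fun _ : Fin 1 => t) a)) =
      Sum.elim v (fun _ => t.realize v) := by
    funext a; cases a <;> rfl
  rw [h]
  exact BoundedFormula.realize_toFormula φ (Sum.elim v fun _ => t.realize v)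

theorem realize_shift (φ : L.Formula ℕ) (v : ℕ → M) :
    (shift φ).Realize v ↔ φ.Realize (fun k => v (k + 1)) :=
  Formula.realize_relabel

theorem realize_openFresh (φ : L.BoundedFormula ℕ 1) (v : ℕ → M) :
    (openFresh φ).Realize v ↔ φ.Realize (fun k => v (k + 1)) (fun _ => v 0) := by
  rw [openFresh, Formula.realize_relabel]
  exact BoundedFormula.realize_toFormula φ _

/-- Soundness of the calculus. -/
theorem Derives.sound {Γ : Set (L.Formula ℕ)} {φ : L.Formula ℕ} (h : Derives Γ φ) :
    ∀ v : ℕ → M, (∀ γ ∈ Γ, γ.Realize v) → φ.Realize v := by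
  induction h with
  | hyp h => exact fun v hv => hv _ h
  | impIntro _ ih =>
    intro v hv
    rw [Formula.realize_imp]
    exact fun hφ => ih v (Set.forall_mem_insert.2 ⟨hφ, hv⟩)
  | impElim _ _ ih₁ ih₂ => exact fun v hv => (Formula.realize_imp.1 (ih₁ v hv)) (ih₂ v hv)
  | @byContra Γ φ _ ih =>
    intro v hv
    by_contra hφ
    exact Formula.realize_bot.1 <| ih v <|
      Set.forall_mem_insert.2 ⟨Formula.realize_imp.2 fun h => (hφ h).elim, hv⟩
  | @allIntro Γ φ _ ih =>
    intro v hv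
    rw [Formula.Realize, BoundedFormula.realize_all]
    intro a
    -- The fresh variable `0` receives `a`, and the old assignment is moved up by one, which `shift`
    -- undoes on the hypotheses.
    have := (realize_openFresh φ (fun k => Nat.casesOn k a v : ℕ → M)).1 (ih _ ?_)
    · rwa [snoc_fin_zero]
    · rintro _ ⟨γ, hγ, rfl⟩
      exact (realize_shift γ _).2 (hv γ hγ)
  | @allElim Γ φ t _ ih =>
    intro v hv
    rw [realize_instTerm]
    have := BoundedFormula.realize_all.1 (ih v hv) (t.realize v)
    rwa [snoc_fin_zero] at this
  | eqRefl t => exact fun v _ => Formula.realize_equal.2 rfl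
  | eqSubst φ _ _ ih₁ ih₂ =>
    intro v hv
    have h₁ := Formula.realize_equal.1 (ih₁ v hv)
    have h₂ := ih₂ v hv
    rw [realize_instTerm] at h₂ ⊢
    rwa [← h₁]

theorem realize_ofSentence (σ : L.Sentence) (v : ℕ → M) : (ofSentence σ).Realize v ↔ M ⊨ σ := by
  rw [ofSentence, Formula.realize_relabel, Sentence.Realize,
    Subsingleton.elim (v ∘ Empty.elim) default]

theorem IsTheorem.realize {T : L.Theory} {σ : L.Sentence} (h : IsTheorem T σ) [Nonempty M]
    (hM : ∀ τ ∈ T, M ⊨ τ) : M ⊨ σ := by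
  refine (realize_ofSentence σ (fun _ => Classical.arbitrary M)).1 (Derives.sound h _ ?_)
  rintro _ ⟨τ, hτ, rfl⟩
  exact (realize_ofSentence τ _).2 (hM τ hτ)

theorem realize_ren {α : Type*} {k l : ℕ} (w : Fin k → Fin l) (φ : L.BoundedFormula α k)
    (v : α → M) (xs : Fin l → M) : (ren w φ).Realize v xs ↔ φ.Realize v (xs ∘ w) := by
  rw [ren]
  refine (BoundedFormula.realize_relabel (n := 0)).trans ?_
  rw [show (xs ∘ Fin.natAdd l : Fin 0 → M) = default from Subsingleton.elim _ _]
  refine (BoundedFormula.realize_toFormula φ _).trans ?_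
  rfl

theorem realize_ren₁ {α : Type*} {l : ℕ} (a : Fin l) (φ : L.BoundedFormula α 1)
    (v : α → M) (xs : Fin l → M) : (ren ![a] φ).Realize v xs ↔ φ.Realize v ![xs a] := by
  rw [realize_ren]
  exact iff_of_eq (congrArg _ (funext fun i => by fin_cases i; rfl))

theorem realize_ren₂ {α : Type*} {l : ℕ} (a b : Fin l) (φ : L.BoundedFormula α 2)
    (v : α → M) (xs : Fin l → M) :
    (ren ![a, b] φ).Realize v xs ↔ φ.Realize v ![xs a, xs b] := by
  rw [realize_ren]
  exact iff_of_eq (congrArg _ (funext fun i => by fin_cases i <;> rfl))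

theorem realize_ren₃ {α : Type*} {l : ℕ} (a b c : Fin l) (φ : L.BoundedFormula α 3)
    (v : α → M) (xs : Fin l → M) :
    (ren ![a, b, c] φ).Realize v xs ↔ φ.Realize v ![xs a, xs b, xs c] := by
  rw [realize_ren]
  exact iff_of_eq (congrArg _ (funext fun i => by fin_cases i <;> rfl))

theorem realize_univClosure {n : ℕ} (φ : L.Formula (Fin n)) :
    M ⊨ univClosure φ ↔ ∀ p : Fin n → M, φ.Realize p := by
  rw [univClosure, Sentence.Realize, Formula.Realize]
  exact (BoundedFormula.realize_alls (v := default)).trans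
    (forall_congr' fun p => Formula.realize_relabel_sumInr φ)

end Semantics

/-! ### Set-theoretic notions inside an arbitrary `∈`-structure -/

section MemStructure

variable {M : Type*} [LMem.Structure M] {α : Type*} {n : ℕ}

/-- The membership relation of an `∈`-structure. -/
def E (a b : M) : Prop := Structure.RelMap (L := LMem) MemRel.mem ![a, b]

theorem realize_memF (s t : LMem.Term (α ⊕ Fin n)) (v : α → M) (xs : Fin n → M) :
    (memF s t).Realize v xs ↔
      E (s.realize (Sum.elim v xs)) (t.realize (Sum.elim v xs)) :=
  BoundedFormula.realize_rel₂

/-- `p` is the Kuratowski pair of `a` and `b`. -/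
def IsPairOf (p a b : M) : Prop :=
  ∀ c, E c p ↔ ((∀ d, E d c ↔ d = a) ∨ ∀ d, E d c ↔ d = a ∨ d = b)

/-- Some pair of `a` and `b` belongs to `f`. -/
def IsApp (f a b : M) : Prop := ∃ p, E p f ∧ IsPairOf p a b

/-- `f` is a function with domain `d`. -/
def IsFunOn (f d : M) : Prop :=
  (∀ p, E p f → ∃ a b, E a d ∧ IsPairOf p a b) ∧ ∀ a, E a d → ∃ b, ∀ c, IsApp f a c ↔ c = b

/-- `w` contains an empty set and successors of its elements. -/
def IsInductive (w : M) : Prop :=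
  (∃ e, E e w ∧ ∀ c, ¬ E c e) ∧ ∀ a, E a w → ∃ b, E b w ∧ ∀ c, E c b ↔ E c a ∨ c = a

/-- `n` belongs to all inductive sets. -/
def IsNat (n : M) : Prop := ∀ w, IsInductive w → E n w

/-- There is a bijection of `x` onto a natural number. -/
def IsFin (x : M) : Prop :=
  ∃ n f : M, ((IsNat n ∧ IsFunOn f x) ∧ (∀ a b, IsApp f a b → E b n)) ∧
    ∀ b, E b n → ∃ a, ∀ c, IsApp f c b ↔ c = a

/-- `f` is a function whose domain is the set of all natural numbers. -/
def IsFunOnOmega (f : M) : Prop := ∃ w, (∀ n, E n w ↔ IsNat n) ∧ IsFunOn f w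

theorem realize_inductiveF (v : α → M) (w : M) :
    (inductiveF (α := α)).Realize v ![w] ↔ IsInductive w := by
  simp [inductiveF, IsInductive, realize_memF,
    BoundedFormula.realize_not]

theorem realize_natF (v : α → M) (n : M) : (natF (α := α)).Realize v ![n] ↔ IsNat n := by
  simp [natF, IsNat, realize_memF, realize_ren₁, realize_inductiveF]

theorem realize_pairF (v : α → M) (p a b : M) :
    (pairF (α := α)).Realize v ![p, a, b] ↔ IsPairOf p a b := by
  simp [pairF, IsPairOf, realize_memF]

theorem realize_appF (v : α → M) (f a b : M) :
    (appF (α := α)).Realize v ![f, a, b] ↔ IsApp f a b := by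
  simp [appF, IsApp, realize_memF, realize_ren₃, realize_pairF]

theorem realize_funOnF (v : α → M) (f d : M) :
    (funOnF (α := α)).Realize v ![f, d] ↔ IsFunOn f d := by
  simp [funOnF, IsFunOn, realize_memF, realize_ren₃,
    realize_pairF, realize_appF]

theorem realize_finiteF (v : α → M) (x : M) : (finiteF (α := α)).Realize v ![x] ↔ IsFin x := by
  simp [finiteF, IsFin, realize_memF,
    realize_ren₃, realize_ren₂, realize_ren₁, realize_natF, realize_funOnF, realize_appF]

theorem realize_omegaF (v : α → M) (w : M) :
    (omegaF (α := α)).Realize v ![w] ↔ ∀ n, E n w ↔ IsNat n := by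
  simp [omegaF, realize_memF, realize_ren₁, realize_natF]

theorem realize_funOnOmegaF (v : α → M) (f : M) :
    (funOnOmegaF (α := α)).Realize v ![f] ↔ IsFunOnOmega f := by
  simp [funOnOmegaF, IsFunOnOmega, realize_ren₁, realize_ren₂, realize_omegaF,
    realize_funOnF]

end MemStructure

/-! ### Structures with a standardness predicate -/

section StStructure

variable {M : Type*} [LMem.Structure M] (S : Set M)

/-- The structure for the language of internal set theory in which the standard sets are the
elements of `S`. -/
@[reducible]
def stStructure : LSt.Structure M where
  funMap f := Empty.elim f
  RelMap r := match r with
    | StRel.mem => fun x => Structure.RelMap (L := LMem) MemRel.mem x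
    | StRel.st => fun x => x 0 ∈ S

theorem isExpansionOn_incl : letI := stStructure S; incl.IsExpansionOn M :=
  let := stStructure S
  { map_onFunction := fun f => Empty.elim f
    map_onRelation := fun R _ => by cases R; rfl }

variable {α : Type*} {n : ℕ} (v : α → M) (xs : Fin n → M)

theorem realize_internal (φ : LMem.BoundedFormula α n) :
    letI := stStructure S; (internal φ).Realize v xs ↔ φ.Realize v xs :=
  let := stStructure S
  haveI := isExpansionOn_incl S
  LHom.realize_onBoundedFormula incl φ

theorem realize_memS (s t : LSt.Term (α ⊕ Fin n)) :
    let := stStructure S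
    (memS s t).Realize v xs ↔ E (s.realize (Sum.elim v xs)) (t.realize (Sum.elim v xs)) :=
  let := stStructure S
  BoundedFormula.realize_rel₂

theorem realize_stS (t : LSt.Term (α ⊕ Fin n)) :
    letI := stStructure S; (stS t).Realize v xs ↔ t.realize (Sum.elim v xs) ∈ S :=
  let := stStructure S
  BoundedFormula.realize_rel₁

theorem realize_allSt (φ : LSt.BoundedFormula α (n + 1)) :
    let := stStructure S
    (allSt φ).Realize v xs ↔ ∀ a ∈ S, φ.Realize v (Fin.snoc xs a : Fin (n + 1) → M) := by
  let := stStructure S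
  simp [allSt, realize_stS]

theorem realize_exSt (φ : LSt.BoundedFormula α (n + 1)) :
    let := stStructure S
    (exSt φ).Realize v xs ↔ ∃ a ∈ S, φ.Realize v (Fin.snoc xs a : Fin (n + 1) → M) := by
  let := stStructure S
  simp [exSt, realize_stS]

theorem realize_allsSt (φ : LSt.BoundedFormula α n) :
    let := stStructure S
    (allsSt φ).Realize v ↔ ∀ p : Fin n → M, (∀ i, p i ∈ S) → φ.Realize v p := by
  let := stStructure S
  induction n with
  | zero =>
    exact ⟨fun h p _ => by rwa [Subsingleton.elim p default], fun h => h _ (fun i => i.elim0)⟩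
  | succ n ih =>
    refine (ih (allSt φ)).trans ?_
    simp only [realize_allSt]
    constructor
    · intro h p hp
      have := h (Fin.init p) (fun i => hp _) (p (Fin.last n)) (hp _)
      rwa [Fin.snoc_init_self] at this
    · intro h p hp a ha
      refine h _ (fun i => ?_)
      refine Fin.lastCases ?_ (fun i => ?_) i
      · rwa [Fin.snoc_last]
      · rw [Fin.snoc_castSucc]; exact hp i

theorem realize_stClosure (φ : LSt.Formula (Fin n)) :
    let := stStructure S
    M ⊨ stClosure φ ↔ ∀ p : Fin n → M, (∀ i, p i ∈ S) → φ.Realize p := by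
  let := stStructure S
  refine (realize_allsSt S default _).trans ?_
  exact forall₂_congr fun p _ => Formula.realize_relabel_sumInr φ

end StStructure

/-! ### The ground model: `ZFSet` satisfies ZFC -/

section GroundModel

instance : LMem.Structure ZFSet.{u} where
  funMap f := Empty.elim f
  RelMap r := match r with
    | MemRel.mem => fun x => x 0 ∈ x 1

theorem E_iff {a b : ZFSet.{u}} : E a b ↔ a ∈ b := Iff.rfl

/-- The von Neumann natural number `k`. -/
def num : ℕ → ZFSet.{u}
  | 0 => ∅
  | k + 1 => insert (num k) (num k)

theorem mem_num {k : ℕ} {x : ZFSet.{u}} : x ∈ num k ↔ ∃ i < k, x = num i := by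
  induction k with
  | zero => simp [num]
  | succ k ih =>
    rw [num, ZFSet.mem_insert_iff, ih]
    constructor
    · rintro (rfl | ⟨i, hi, rfl⟩)
      exacts [⟨k, by lia, rfl⟩, ⟨i, by lia, rfl⟩]
    · rintro ⟨i, hi, rfl⟩
      rcases Nat.lt_succ_iff_lt_or_eq.1 hi with h | rfl
      exacts [Or.inr ⟨i, h, rfl⟩, Or.inl rfl]

theorem num_injective : Function.Injective num.{u} := by
  intro i j h
  by_contra hne
  rcases Nat.lt_or_gt_of_ne hne with hij | hij
  · exact ZFSet.mem_irrefl (num j) (mem_num.2 ⟨i, hij, h.symm⟩)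
  · exact ZFSet.mem_irrefl (num i) (mem_num.2 ⟨j, hij, h⟩)

theorem isInductive_range_num : IsInductive (ZFSet.range num.{u}) := by
  refine ⟨⟨num 0, ZFSet.mem_range_self _, ZFSet.notMem_empty⟩, fun a ha => ?_⟩
  obtain ⟨k, rfl⟩ := ZFSet.mem_range.1 (E_iff.1 ha)
  refine ⟨num (k + 1), ZFSet.mem_range_self _, fun c => ?_⟩
  rw [E_iff, num, ZFSet.mem_insert_iff, or_comm, E_iff]

/-- The set of all `num k` is itself inductive, so the natural numbers of `ZFSet` are the actual
ones. -/
theorem isNat_iff {n : ZFSet.{u}} : IsNat n ↔ ∃ k, n = num k := by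
  constructor
  · intro h
    obtain ⟨k, hk⟩ := ZFSet.mem_range.1 (h _ isInductive_range_num)
    exact ⟨k, hk.symm⟩
  · rintro ⟨k, rfl⟩ w ⟨⟨e, he, he'⟩, hs⟩
    induction k with
    | zero =>
      have : e = ∅ := (ZFSet.eq_empty e).2 he'
      rwa [this] at he
    | succ k ih =>
      obtain ⟨b, hb, hb'⟩ := hs _ ih
      have : b = num (k + 1) := by
        ext c
        rw [num, ZFSet.mem_insert_iff, or_comm]
        exact hb' c
      rwa [this] at hb

theorem isPairOf_iff {p a b : ZFSet.{u}} : IsPairOf p a b ↔ p = ZFSet.pair a b := by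
  have h₁ (c : ZFSet.{u}) : (∀ d, E d c ↔ d = a) ↔ c = {a} := by simp [ZFSet.ext_iff, E_iff]
  have h₂ (c : ZFSet.{u}) : (∀ d, E d c ↔ d = a ∨ d = b) ↔ c = {a, b} := by
    simp [ZFSet.ext_iff, E_iff]
  simp only [IsPairOf, h₁, h₂]
  rw [ZFSet.ext_iff]
  simp [ZFSet.pair, E_iff]

theorem isApp_iff {f a b : ZFSet.{u}} : IsApp f a b ↔ ZFSet.pair a b ∈ f := by
  simp [IsApp, isPairOf_iff, E_iff]

theorem isFunOn_iff {f d : ZFSet.{u}} : IsFunOn f d ↔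
    (∀ p ∈ f, ∃ a b, a ∈ d ∧ p = ZFSet.pair a b) ∧
      ∀ a ∈ d, ∃ b, ∀ c, ZFSet.pair a c ∈ f ↔ c = b := by
  simp only [IsFunOn, isPairOf_iff, isApp_iff, E_iff]

/-- The index type is kept general because it serves both sequences on `ω` and enumerations of
finite sets. -/
theorem isFunOn_range {ι : Type*} [Small.{u} ι] {e : ι → ZFSet.{u}} (he : Function.Injective e)
    (g : ι → ZFSet.{u}) {d : ZFSet.{u}} (hd : ∀ x, x ∈ d ↔ ∃ i, x = e i) :
    IsFunOn (ZFSet.range fun i => ZFSet.pair (e i) (g i)) d := by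
  rw [isFunOn_iff]
  constructor
  · intro p hp
    obtain ⟨i, rfl⟩ := ZFSet.mem_range.1 hp
    exact ⟨_, _, (hd _).2 ⟨i, rfl⟩, rfl⟩
  · intro a ha
    obtain ⟨i, rfl⟩ := (hd a).1 ha
    refine ⟨g i, fun c => ?_⟩
    rw [ZFSet.mem_range]
    constructor
    · rintro ⟨j, hj⟩
      obtain ⟨h₁, h₂⟩ := ZFSet.pair_inj.1 hj
      rw [← h₂, he h₁]
    · rintro rfl
      exact ⟨i, rfl⟩

theorem isFunOnOmega_range (g : ℕ → ZFSet.{u}) :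
    IsFunOnOmega (ZFSet.range fun k => ZFSet.pair (num k) (g k)) := by
  refine ⟨ZFSet.range num, fun n => ?_, isFunOn_range num_injective g fun x => ?_⟩
  · rw [E_iff, ZFSet.mem_range, isNat_iff]
    simp only [eq_comm]
  · rw [ZFSet.mem_range]
    simp only [eq_comm]

/-- Since the natural numbers of `ZFSet` are the actual ones, finiteness in its sense is actual
finiteness. Idealization needs this to match standard finite sets with finite families. -/
theorem isFin_iff {x : ZFSet.{u}} : IsFin x ↔ {y | y ∈ x}.Finite := by
  constructor
  · rintro ⟨n, f, ⟨⟨hn, hf⟩, hv⟩, hinj⟩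
    obtain ⟨k, rfl⟩ := isNat_iff.1 hn
    rw [isFunOn_iff] at hf
    simp only [isApp_iff, E_iff] at hv hinj
    choose! g hg using hf.2
    have hgf (a) (ha : a ∈ x) : ZFSet.pair a (g a) ∈ f := (hg a ha _).2 rfl
    have hfin : {y : ZFSet.{u} | y ∈ num k}.Finite := by
      refine ((Set.finite_lt_nat k).image num).subset fun y hy => ?_
      obtain ⟨i, hi, rfl⟩ := mem_num.1 hy
      exact ⟨i, hi, rfl⟩
    refine Set.Finite.of_injOn (f := g) (t := {y | y ∈ num k}) (fun a ha => hv _ _ (hgf a ha)) ?_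
      hfin
    intro a ha b hb hab
    obtain ⟨c, hc⟩ := hinj _ (hv _ _ (hgf a ha))
    rw [(hc a).1 (hgf a ha), (hc b).1 (hab ▸ hgf b hb)]
  · intro h
    obtain ⟨k, ⟨e⟩⟩ := @Finite.exists_equiv_fin {y | y ∈ x} h
    have hd (y) : y ∈ x ↔ ∃ i, y = (e.symm i : ZFSet.{u}) :=
      ⟨fun hy => ⟨e ⟨y, hy⟩, by simp⟩, by rintro ⟨i, rfl⟩; exact (e.symm i).2⟩
    have he : Function.Injective fun i => (e.symm i : ZFSet.{u}) :=
      Subtype.val_injective.comp e.symm.injective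
    refine ⟨num k, ZFSet.range fun i => ZFSet.pair (e.symm i : ZFSet.{u}) (num i),
      ⟨⟨isNat_iff.2 ⟨k, rfl⟩, isFunOn_range he _ hd⟩, fun a b hab => ?_⟩, fun b hb => ?_⟩
    · obtain ⟨i, hi⟩ := ZFSet.mem_range.1 (isApp_iff.1 hab)
      exact mem_num.2 ⟨i, i.2, (ZFSet.pair_inj.1 hi).2.symm⟩
    · obtain ⟨i, hi, rfl⟩ := mem_num.1 hb
      refine ⟨e.symm ⟨i, hi⟩, fun c => ?_⟩
      rw [isApp_iff, ZFSet.mem_range]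
      constructor
      · rintro ⟨j, hj⟩
        obtain ⟨h₁, h₂⟩ := ZFSet.pair_inj.1 hj
        have : j = ⟨i, hi⟩ := Fin.ext (num_injective h₂)
        rw [← h₁, this]
      · rintro rfl
        exact ⟨⟨i, hi⟩, rfl⟩

theorem realize_extensionality : ZFSet.{u} ⊨ extensionality := by
  simp only [extensionality, Sentence.Realize, Formula.Realize, realize_memF, E_iff,
    BoundedFormula.realize_all, BoundedFormula.realize_imp, BoundedFormula.realize_iff,
    BoundedFormula.realize_bdEqual]
  exact fun x y h => ZFSet.ext h

theorem realize_foundation : ZFSet.{u} ⊨ foundation := by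
  simp only [foundation, Sentence.Realize, Formula.Realize, realize_memF, E_iff,
    BoundedFormula.realize_all, BoundedFormula.realize_imp, BoundedFormula.realize_ex,
    BoundedFormula.realize_inf, BoundedFormula.realize_not]
  rintro x ⟨y, hy⟩
  obtain ⟨z, hz, h⟩ := ZFSet.regularity x (by rintro rfl; exact ZFSet.notMem_empty _ hy)
  refine ⟨z, hz, fun c hc hcz => ZFSet.notMem_empty c ?_⟩
  rw [← h]
  exact ZFSet.mem_inter.2 ⟨hc, hcz⟩

theorem realize_pairing : ZFSet.{u} ⊨ pairing := by
  simp only [pairing, Sentence.Realize, Formula.Realize, realize_memF, E_iff,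
    BoundedFormula.realize_all, BoundedFormula.realize_ex,
    BoundedFormula.realize_iff, BoundedFormula.realize_sup, BoundedFormula.realize_bdEqual]
  exact fun x y => ⟨{x, y}, fun z => ZFSet.mem_pair⟩

theorem realize_union : ZFSet.{u} ⊨ union := by
  simp only [union, Sentence.Realize, Formula.Realize, realize_memF, E_iff,
    BoundedFormula.realize_all, BoundedFormula.realize_ex,
    BoundedFormula.realize_iff, BoundedFormula.realize_inf]
  exact fun x => ⟨ZFSet.sUnion x, fun z => ZFSet.mem_sUnion⟩

theorem realize_powerSet : ZFSet.{u} ⊨ powerSet := by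
  simp only [powerSet, Sentence.Realize, Formula.Realize, realize_memF, E_iff,
    BoundedFormula.realize_all, BoundedFormula.realize_ex,
    BoundedFormula.realize_iff, BoundedFormula.realize_imp]
  exact fun x => ⟨ZFSet.powerset x, fun z => ZFSet.mem_powerset⟩

theorem realize_infinity : ZFSet.{u} ⊨ infinity := by
  refine BoundedFormula.realize_ex.2 ⟨ZFSet.range num, ?_⟩
  rw [snoc_fin_zero]
  convert (realize_inductiveF default _).2 isInductive_range_num using 1
  funext i; fin_cases i; rfl

theorem realize_choice : ZFSet.{u} ⊨ choice := by
  simp only [choice, Sentence.Realize, Formula.Realize, realize_memF, E_iff,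
    BoundedFormula.realize_all, BoundedFormula.realize_ex, BoundedFormula.realize_bdEqual,
    BoundedFormula.realize_iff, BoundedFormula.realize_imp, BoundedFormula.realize_inf]
  rintro x ⟨hne, hdisj⟩
  change ∀ y, y ∈ x → ∃ z, z ∈ y at hne
  change ∀ y z, (y ∈ x ∧ z ∈ x) ∧ (∃ w, w ∈ y ∧ w ∈ z) → y = z at hdisj
  change ∃ c, ∀ y, y ∈ x → ∃ a, ∀ b, b ∈ y ∧ b ∈ c ↔ b = a
  choose! g hg using hne
  refine ⟨ZFSet.sep (fun z => ∃ y ∈ x, z = g y) (ZFSet.sUnion x), fun y hy => ⟨g y, fun b => ?_⟩⟩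
  rw [ZFSet.mem_sep, ZFSet.mem_sUnion]
  constructor
  · rintro ⟨hb, -, z, hz, rfl⟩
    rw [hdisj y z ⟨⟨hy, hz⟩, _, hb, hg z hz⟩]
  · rintro rfl
    exact ⟨hg y hy, ⟨y, hy, hg y hy⟩, y, hy, rfl⟩

theorem realize_separation {n : ℕ} (φ : LMem.BoundedFormula (Fin n) 1) :
    ZFSet.{u} ⊨ separation φ := by
  rw [separation, realize_univClosure]
  intro p
  simp only [Formula.Realize, realize_memF, E_iff,
    BoundedFormula.realize_all, BoundedFormula.realize_ex,
    BoundedFormula.realize_iff, BoundedFormula.realize_inf, realize_ren₁]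
  intro X
  change ∃ Y, ∀ x, x ∈ Y ↔ x ∈ X ∧ φ.Realize p ![x]
  exact ⟨ZFSet.sep (fun x => φ.Realize p ![x]) X, fun x => ZFSet.mem_sep⟩

theorem realize_replacement {n : ℕ} (φ : LMem.BoundedFormula (Fin n) 2) :
    ZFSet.{u} ⊨ replacement φ := by
  rw [replacement, realize_univClosure]
  intro p
  simp only [Formula.Realize, realize_memF, E_iff,
    BoundedFormula.realize_all, BoundedFormula.realize_ex, BoundedFormula.realize_bdEqual,
    BoundedFormula.realize_iff, BoundedFormula.realize_imp, BoundedFormula.realize_inf,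
    realize_ren₂]
  intro A hA
  change ∀ x, x ∈ A → ∀ y z, φ.Realize p ![x, y] ∧ φ.Realize p ![x, z] → y = z at hA
  change ∃ B, ∀ y, y ∈ B ↔ ∃ x, x ∈ A ∧ φ.Realize p ![x, y]
  classical
  let g (x : ZFSet.{u}) : ZFSet.{u} := if h : ∃ y, φ.Realize p ![x, y] then h.choose else ∅
  have hg {x y : ZFSet.{u}} (hx : x ∈ A) (h : φ.Realize p ![x, y]) : g x = y := by
    have h' : ∃ y, φ.Realize p ![x, y] := ⟨y, h⟩
    simp only [g, dif_pos h']
    exact hA x hx _ _ ⟨h'.choose_spec, h⟩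
  let : ZFSet.Definable₁ g := Classical.allZFSetDefinable _
  -- The image also contains the default value `∅` whenever some point of `A` has no value;
  -- separation removes it if it is not a genuine value.
  refine ⟨ZFSet.sep (fun y => ∃ x ∈ A, φ.Realize p ![x, y]) (ZFSet.image g A), fun y => ?_⟩
  rw [ZFSet.mem_sep, ZFSet.mem_image]
  constructor
  · rintro ⟨-, x, hx, h⟩
    exact ⟨x, hx, h⟩
  · rintro ⟨x, hx, h⟩
    exact ⟨⟨x, hx, hg hx h⟩, x, hx, h⟩

theorem realize_ZFC {σ : LMem.Sentence} (hσ : σ ∈ ZFC) : ZFSet.{u} ⊨ σ := by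
  cases hσ with
  | extensionality => exact realize_extensionality
  | foundation => exact realize_foundation
  | pairing => exact realize_pairing
  | union => exact realize_union
  | powerSet => exact realize_powerSet
  | infinity => exact realize_infinity
  | choice => exact realize_choice
  | separation φ => exact realize_separation φ
  | replacement φ => exact realize_replacement φ

end GroundModel

/-! ### Saturated elementary extensions by iterated ultrapowers -/

section Saturation

variable {L : FirstOrder.Language.{u, v}}

/-- An ultrafilter on the finite subsets of `W` that contains all the cones `{A | A₀ ⊆ A}`. -/
noncomputable def fineUltrafilter (W : Type w) : Ultrafilter (Finset W) :=
  Ultrafilter.of Filter.atTop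

theorem eventually_fineUltrafilter {W : Type w} (A : Finset W) :
    ∀ᶠ B in (fineUltrafilter W : Filter (Finset W)), A ⊆ B :=
  Ultrafilter.of_le _ (Filter.eventually_ge_atTop A)

/-- The ultrapower of `M` by the fine ultrafilter on the finite subsets of `W`. -/
abbrev FinePower (W M : Type w) : Type w :=
  (fineUltrafilter W : Filter (Finset W)).Product fun _ => M

section FinePower

variable (W M : Type w)

/-- The diagonal map into the ultrapower. -/
noncomputable def diagonal (a : M) : FinePower W M := ((fun _ => a : Finset W → M) : FinePower W M)

variable {W M} [L.Structure M] [Nonempty M]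

theorem realize_diagonal {α : Type*} {n : ℕ} (φ : L.BoundedFormula α n) (p : α → M)
    (xs : Fin n → M) :
    φ.Realize (fun i => diagonal W M (p i)) (fun i => diagonal W M (xs i)) ↔ φ.Realize p xs := by
  refine (Ultraproduct.boundedFormula_realize_cast φ (fun i _ => p i) (fun i _ => xs i)).trans ?_
  simp

/-- For each finite `A` choose a solution for the conditions indexed by `A ∩ S`. The class of this
choice solves all conditions at once: for `a ∈ S`, the sets `A` containing `a` form a cone, which
lies in the ultrafilter. -/
theorem exists_realize_finePower (j : W → M) {n : ℕ} (φ : L.BoundedFormula (Fin n) 2)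
    (p : Fin n → M) (S : Set W)
    (h : ∀ A : Finset W, (A : Set W) ⊆ S → ∃ x, ∀ a ∈ A, φ.Realize p ![x, j a]) :
    ∃ x : FinePower W M, ∀ a ∈ S,
      φ.Realize (fun i => diagonal W M (p i)) ![x, diagonal W M (j a)] := by
  classical
  choose x hx using fun A : Finset W => h (A.filter (· ∈ S))
    (fun a ha => (Finset.mem_filter.1 ha).2)
  refine ⟨(x : FinePower W M), fun a ha => ?_⟩
  have h₁ : (![(x : FinePower W M), diagonal W M (j a)] : Fin 2 → FinePower W M) =
      fun i => ((![x, fun _ => j a] i : Finset W → M) : FinePower W M) := by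
    funext i; fin_cases i <;> rfl
  rw [h₁]
  refine (Ultraproduct.boundedFormula_realize_cast φ (fun i _ => p i) ![x, fun _ => j a]).2 ?_
  filter_upwards [eventually_fineUltrafilter {a}] with A hA
  have h₂ : (fun i => (![x, fun _ => j a] : Fin 2 → Finset W → M) i A) = ![x A, j a] := by
    funext i; fin_cases i <;> rfl
  rw [h₂]
  exact hx A a (Finset.mem_filter.2 ⟨hA (Finset.mem_singleton_self a), ha⟩)

end FinePower

/-- A nonempty structure. -/
structure NonemptyStructure (L : FirstOrder.Language.{u, v}) where
  /-- The universe of the structure. -/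
  carrier : Type w
  str : L.Structure carrier
  nonempty : Nonempty carrier

attribute [instance] NonemptyStructure.str NonemptyStructure.nonempty

variable (L) (W : Type w) [L.Structure W] [Nonempty W]

/-- The iterated fine ultrapowers of `W`. -/
noncomputable def iteratedPower : ℕ → NonemptyStructure.{u, v, w} L
  | 0 => ⟨W, inferInstance, inferInstance⟩
  | n + 1 => ⟨FinePower W (iteratedPower n).carrier, inferInstance, inferInstance⟩

/-- The diagonal elementary embedding between consecutive ultrapowers. -/
noncomputable def iteratedPowerSucc (n : ℕ) :
    (iteratedPower L W n).carrier ↪ₑ[L] (iteratedPower L W (n + 1)).carrier where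
  toFun := diagonal W _
  map_formula' _ φ x := (iff_of_eq (congrArg (BoundedFormula.Realize φ _)
    (Subsingleton.elim _ _))).trans (realize_diagonal φ x default)

/-- The embeddings between the iterated ultrapowers. -/
noncomputable def iteratedPowerMap (m n : ℕ) (h : m ≤ n) :
    (iteratedPower L W m).carrier ↪[L] (iteratedPower L W n).carrier :=
  DirectedSystem.natLERec (fun n => (iteratedPowerSucc L W n).toEmbedding) m n h

instance : DirectedSystem (fun n => (iteratedPower L W n).carrier)
    fun m n h => iteratedPowerMap L W m n h :=
  DirectedSystem.natLERec.directedSystem _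

variable {L W}

theorem iteratedPowerMap_self (n : ℕ) (a : (iteratedPower L W n).carrier) :
    iteratedPowerMap L W n n le_rfl a = a :=
  DirectedSystem.map_self (f := fun m n h => iteratedPowerMap L W m n h) a

theorem iteratedPowerMap_succ {m n : ℕ} (h : m ≤ n) (a : (iteratedPower L W m).carrier) :
    iteratedPowerMap L W m (n + 1) (h.trans n.le_succ) a =
      iteratedPowerSucc L W n (iteratedPowerMap L W m n h a) := by
  simp only [iteratedPowerMap, DirectedSystem.coe_natLERec]
  exact Nat.leRecOn_succ (C := fun n => (iteratedPower L W n).carrier) h a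

theorem realize_iteratedPowerMap {m n : ℕ} (h : m ≤ n) {α : Type*} {k : ℕ}
    (φ : L.BoundedFormula α k) (p : α → (iteratedPower L W m).carrier)
    (xs : Fin k → (iteratedPower L W m).carrier) :
    φ.Realize (iteratedPowerMap L W m n h ∘ p) (iteratedPowerMap L W m n h ∘ xs) ↔
      φ.Realize p xs := by
  induction n, h using Nat.le_induction with
  | base =>
    rw [show ⇑(iteratedPowerMap L W m m le_rfl) = id from funext (iteratedPowerMap_self m)]
    rfl
  | succ n h ih =>
    rw [show ⇑(iteratedPowerMap L W m (n + 1) (h.trans n.le_succ)) =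
      iteratedPowerSucc L W n ∘ iteratedPowerMap L W m n h from funext (iteratedPowerMap_succ h)]
    exact ((iteratedPowerSucc L W n).map_boundedFormula φ _ _).trans ih

variable (L W)

/-- The limit of the iterated ultrapowers. -/
abbrev LimitPower : Type w :=
  Language.DirectLimit (fun n => (iteratedPower L W n).carrier) (iteratedPowerMap L W)

/-- The embedding of an iterated ultrapower in the limit. -/
noncomputable def toLimit (n : ℕ) : (iteratedPower L W n).carrier ↪[L] LimitPower L W :=
  DirectLimit.of L ℕ (fun n => (iteratedPower L W n).carrier) (iteratedPowerMap L W) n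

variable {L W}

theorem toLimit_map {m n : ℕ} (h : m ≤ n) (a : (iteratedPower L W m).carrier) :
    toLimit L W n (iteratedPowerMap L W m n h a) = toLimit L W m a :=
  DirectLimit.of_f (G := fun n => (iteratedPower L W n).carrier) (f := iteratedPowerMap L W)

theorem exists_toLimit (b : LimitPower L W) : ∃ n a, toLimit L W n a = b :=
  DirectLimit.exists_of (G := fun n => (iteratedPower L W n).carrier)
    (f := iteratedPowerMap L W) b

theorem exists_toLimit_comp {α : Type*} [Finite α] (p : α → LimitPower L W) :
    ∃ (n : ℕ) (q : α → (iteratedPower L W n).carrier), p = toLimit L W n ∘ q :=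
  DirectLimit.exists_quotient_mk'_sigma_mk'_eq (fun n => (iteratedPower L W n).carrier)
    (iteratedPowerMap L W) p

/-- This is the elementary chain theorem. In the quantifier step an arbitrary element of the limit
already occurs at some stage, and everything is moved to a common later stage, which is why `m` must
vary in the induction. -/
theorem realize_toLimit {m : ℕ} {α : Type*} {k : ℕ}
    (φ : L.BoundedFormula α k) (p : α → (iteratedPower L W m).carrier)
    (xs : Fin k → (iteratedPower L W m).carrier) :
    φ.Realize (toLimit L W m ∘ p) (toLimit L W m ∘ xs) ↔ φ.Realize p xs := by
  induction φ generalizing m with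
  | falsum => rfl
  | equal t₁ t₂ =>
    simp only [BoundedFormula.Realize, ← Sum.comp_elim, HomClass.realize_term]
    exact (toLimit L W m).injective.eq_iff
  | rel R ts =>
    simp only [BoundedFormula.Realize, ← Sum.comp_elim, HomClass.realize_term]
    exact (toLimit L W m).map_rel R _
  | imp _ _ ih₁ ih₂ => exact imp_congr (ih₁ p xs) (ih₂ p xs)
  | all φ ih =>
    simp only [BoundedFormula.realize_all]
    constructor
    · intro h a
      rw [← ih, Fin.comp_snoc]
      exact h _
    · intro h b
      obtain ⟨n, a, rfl⟩ := exists_toLimit b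
      have hm := le_max_left m n
      have key := (realize_iteratedPowerMap hm φ.all p xs).2 h
        (iteratedPowerMap L W n _ (le_max_right m n) a)
      rw [← ih, Fin.comp_snoc] at key
      convert key using 2
      · funext i; exact (toLimit_map hm _).symm
      · funext i; exact (toLimit_map hm _).symm
      · exact (toLimit_map (le_max_right m n) _).symm

variable (L W)

/-- The elementary embedding of `W` in the limit of its iterated ultrapowers. -/
noncomputable def limitEmbedding : W ↪ₑ[L] LimitPower L W where
  toFun := toLimit L W 0
  map_formula' _ φ x := (iff_of_eq (congrArg (BoundedFormula.Realize φ _)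
    (Subsingleton.elim _ _))).trans (realize_toLimit (m := 0) φ x default)

variable {L W}

/-- A single ultrapower realizes only types whose parameters come from the structure below it. In
the limit, finitely many parameters appear at some stage `m`, and the next stage contains a
realization. -/
theorem exists_realize_limitPower {n : ℕ} (φ : L.BoundedFormula (Fin n) 2)
    (p : Fin n → LimitPower L W) (S : Set W)
    (h : ∀ A : Finset W, (A : Set W) ⊆ S →
      ∃ x, ∀ a ∈ A, φ.Realize p ![x, limitEmbedding L W a]) :
    ∃ x, ∀ a ∈ S, φ.Realize p ![x, limitEmbedding L W a] := by
  obtain ⟨m, q, rfl⟩ := exists_toLimit_comp p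
  let j : W → (iteratedPower L W m).carrier := iteratedPowerMap L W 0 m (Nat.zero_le m)
  have hj (a : W) : limitEmbedding L W a = toLimit L W m (j a) :=
    (toLimit_map (Nat.zero_le m) (show (iteratedPower L W 0).carrier from a)).symm
  have key : ∀ A : Finset W, (A : Set W) ⊆ S → ∃ x, ∀ a ∈ A, φ.Realize q ![x, j a] := by
    intro A hA
    -- Finite satisfiability is known in the limit and wanted at stage `m`. Since `A` is finite, it
    -- is one existential formula with parameters at that stage, so it descends by elementarity.
    let ψ : L.BoundedFormula (Fin n ⊕ A) 1 := BoundedFormula.iInf fun a : A =>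
      BoundedFormula.relabel (k := 0)
        (Sum.elim (fun i => Sum.inl (Sum.inl i)) ![Sum.inr 0, Sum.inl (Sum.inr a)]) φ.toFormula
    have hψ {M : Type w} [L.Structure M] (v : Fin n ⊕ A → M) (xs : Fin 1 → M) :
        ψ.Realize v xs ↔ ∀ a : A, φ.Realize (v ∘ Sum.inl) ![xs 0, v (Sum.inr a)] := by
      rw [BoundedFormula.realize_iInf]
      refine forall_congr' fun a => ?_
      refine (BoundedFormula.realize_relabel (n := 0)).trans ?_
      rw [show (xs ∘ Fin.natAdd 1 : Fin 0 → M) = default from Subsingleton.elim _ _]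
      refine (BoundedFormula.realize_toFormula φ _).trans (iff_of_eq (congrArg _ ?_))
      funext i; fin_cases i <;> rfl
    obtain ⟨x, hx⟩ := h A hA
    have h₁ : ψ.ex.Realize (toLimit L W m ∘ Sum.elim q fun a : A => j a)
        (toLimit L W m ∘ (default : Fin 0 → _)) := by
      refine BoundedFormula.realize_ex.2 ⟨x, (hψ _ _).2 fun a => ?_⟩
      have := hx a a.2
      rw [hj] at this
      rw [snoc_fin_zero]
      exact this
    obtain ⟨y, hy⟩ := BoundedFormula.realize_ex.1 ((realize_toLimit ψ.ex _ _).1 h₁)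
    refine ⟨y, fun a ha => ?_⟩
    exact (hψ _ _).1 hy ⟨a, ha⟩
  obtain ⟨x, hx⟩ := exists_realize_finePower j φ q S key
  refine ⟨toLimit L W (m + 1) x, fun a ha => ?_⟩
  have := (realize_toLimit (m := m + 1) φ _ _).2 (hx a ha)
  have e (b : (iteratedPower L W m).carrier) :
      toLimit L W (m + 1) (diagonal W _ b) = toLimit L W m b := by
    rw [← toLimit_map m.le_succ, iteratedPowerMap_succ le_rfl, iteratedPowerMap_self]
    rfl
  convert this using 1
  · funext i
    exact (e _).symm
  · funext i
    fin_cases i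
    · rfl
    · exact (hj a).trans (e _).symm

end Saturation

/-! ### The meaning of `star` in a structure with standard sets -/

section Star

variable {M : Type*} [LMem.Structure M] (S : Set M)

theorem realize_star :
    letI := stStructure S
    M ⊨ star ↔ ∀ F : M, IsFunOnOmega F → (∀ n ∈ S, IsNat n → ∃ y ∈ S, IsApp F n y) →
      ∃ G ∈ S, IsFunOnOmega G ∧ ∀ n ∈ S, IsNat n → ∃ y, IsApp F n y ∧ IsApp G n y := by
  let := stStructure S
  simp only [star, Sentence.Realize, Formula.Realize, BoundedFormula.realize_all,
    BoundedFormula.realize_imp, realize_allSt, realize_exSt, BoundedFormula.realize_inf,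
    BoundedFormula.realize_ex, realize_internal, realize_ren₁, realize_ren₃]
  have h₁ (F : M) : (Fin.snoc default F : Fin (0 + 1) → M) = ![F] := by
    funext i; fin_cases i; rfl
  simp only [h₁, realize_funOnOmegaF, realize_natF, realize_appF]
  rfl

theorem IsFunOnOmega.app_unique {f n a b : M} (hf : IsFunOnOmega f) (hn : IsNat n)
    (ha : IsApp f n a) (hb : IsApp f n b) : a = b := by
  obtain ⟨w, hw, -, h⟩ := hf
  obtain ⟨c, hc⟩ := h n ((hw n).2 hn)
  rw [(hc a).1 ha, (hc b).1 hb]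

end Star

/-- An elementary substructure of the universe that contains all elements and all subsets of its
elements, and `{x} ∪ y` for all `x` and `y` in it. -/
structure IsSupertransitive (W : LMem.ElementarySubstructure ZFSet.{u}) : Prop where
  mem_of_mem : ∀ x ∈ W, ∀ y ∈ x, y ∈ W
  mem_of_subset : ∀ x ∈ W, ∀ y ⊆ x, y ∈ W
  insert_mem : ∀ x ∈ W, ∀ y ∈ W, insert x y ∈ W

namespace IsSupertransitive

variable {W : LMem.ElementarySubstructure ZFSet.{u}} (hW : IsSupertransitive W)

include hW

theorem empty_mem : ∅ ∈ W := by
  obtain ⟨x⟩ := (inferInstance : Nonempty W)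
  exact hW.mem_of_subset x x.2 ∅ (ZFSet.empty_subset _)

theorem num_mem (k : ℕ) : num k ∈ W := by
  induction k with
  | zero => exact hW.empty_mem
  | succ k ih => exact hW.insert_mem _ ih _ ih

theorem pair_mem {x y : ZFSet.{u}} (hx : x ∈ W) (hy : y ∈ W) : ZFSet.pair x y ∈ W := by
  have h (z) (hz : z ∈ W) : ({z} : ZFSet.{u}) ∈ W := hW.insert_mem z hz ∅ hW.empty_mem
  exact hW.insert_mem _ (h x hx) _ (h _ (hW.insert_mem _ hx _ (h y hy)))

end IsSupertransitive

/-! ### Saturated extensions of supertransitive submodels as models of `IST` -/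

section Extension

variable {W : LMem.ElementarySubstructure ZFSet.{u}} {M : Type*} [LMem.Structure M]
  (j : W ↪ₑ[LMem] M)

/-- `W` is elementary both in `M` and in `ZFSet`, so facts about standard elements of `M` can be
computed in the universe, bypassing `W`. -/
theorem realize_standard {α : Type*} {n : ℕ} (φ : LMem.BoundedFormula α n) (p : α → W)
    (xs : Fin n → W) :
    φ.Realize (fun i => j (p i)) (fun i => j (xs i)) ↔
      φ.Realize (fun i => (p i : ZFSet.{u})) (fun i => (xs i : ZFSet.{u})) :=
  (j.map_boundedFormula φ p xs).trans (W.subtype.map_boundedFormula φ p xs).symm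

theorem vec_one {A B : Type*} (f : A → B) (a : A) : ![f a] = fun i => f (![a] i) := by
  funext i; fin_cases i; rfl

theorem vec_two {A B : Type*} (f : A → B) (a b : A) : ![f a, f b] = fun i => f (![a, b] i) := by
  funext i; fin_cases i <;> rfl

theorem vec_three {A B : Type*} (f : A → B) (a b c : A) :
    ![f a, f b, f c] = fun i => f (![a, b, c] i) := by
  funext i; fin_cases i <;> rfl

theorem realize_standard₁ (φ : LMem.BoundedFormula Empty 1) (a : W) :
    φ.Realize default ![j a] ↔ φ.Realize default ![(a : ZFSet.{u})] := by
  rw [vec_one, vec_one (Subtype.val : W → ZFSet.{u})]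
  convert realize_standard j φ default ![a] using 2

theorem realize_standard₂ (φ : LMem.BoundedFormula Empty 2) (a b : W) :
    φ.Realize default ![j a, j b] ↔ φ.Realize default ![(a : ZFSet.{u}), (b : ZFSet.{u})] := by
  rw [vec_two, vec_two (Subtype.val : W → ZFSet.{u})]
  convert realize_standard j φ default ![a, b] using 2

theorem realize_standard₃ (φ : LMem.BoundedFormula Empty 3) (a b c : W) :
    φ.Realize default ![j a, j b, j c] ↔
      φ.Realize default ![(a : ZFSet.{u}), (b : ZFSet.{u}), (c : ZFSet.{u})] := by
  rw [vec_three, vec_three (Subtype.val : W → ZFSet.{u})]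
  convert realize_standard j φ default ![a, b, c] using 2

theorem E_standard (a b : W) : E (j a) (j b) ↔ (a : ZFSet.{u}) ∈ (b : ZFSet.{u}) := by
  have := realize_standard₂ j (memF &0 &1) a b
  rwa [realize_memF, realize_memF] at this

theorem isNat_standard (a : W) : IsNat (j a) ↔ IsNat (a : ZFSet.{u}) := by
  have := realize_standard₁ j natF a
  rwa [realize_natF, realize_natF] at this

theorem isFin_standard (a : W) : IsFin (j a) ↔ IsFin (a : ZFSet.{u}) := by
  have := realize_standard₁ j finiteF a
  rwa [realize_finiteF, realize_finiteF] at this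

theorem isFunOnOmega_standard (a : W) : IsFunOnOmega (j a) ↔ IsFunOnOmega (a : ZFSet.{u}) := by
  have := realize_standard₁ j funOnOmegaF a
  rwa [realize_funOnOmegaF, realize_funOnOmegaF] at this

theorem isPairOf_standard (p a b : W) :
    IsPairOf (j p) (j a) (j b) ↔ IsPairOf (p : ZFSet.{u}) (a : ZFSet.{u}) b := by
  have := realize_standard₃ j pairF p a b
  rwa [realize_pairF, realize_pairF] at this

theorem isApp_standard (f a b : W) :
    IsApp (j f) (j a) (j b) ↔ IsApp (f : ZFSet.{u}) (a : ZFSet.{u}) b := by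
  have := realize_standard₃ j appF f a b
  rwa [realize_appF, realize_appF] at this

/-- `&0 = {&1} ∪ &2` -/
def insertF : LMem.BoundedFormula Empty 3 :=
  ∀' (memF &3 &0 ⇔ (&3 =' &1 ⊔ memF &3 &2))

theorem realize_insertF {M : Type*} [LMem.Structure M] (t a s : M) :
    insertF.Realize default ![t, a, s] ↔ ∀ b, E b t ↔ b = a ∨ E b s := by
  simp [insertF, realize_memF]

theorem E_insert_standard (t a s : W)
    (h : (t : ZFSet.{u}) = insert (a : ZFSet.{u}) (s : ZFSet.{u})) (b : M) :
    E b (j t) ↔ b = j a ∨ E b (j s) := by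
  refine (realize_insertF _ _ _).1 ((realize_standard₃ j insertF t a s).2 ?_) b
  refine (realize_insertF _ _ _).2 fun b => ?_
  rw [h]
  exact ZFSet.mem_insert_iff

/-- Every finite set of standard sets is the extension, in the sense of the ground model and in the
sense of the extension, of a standard set. -/
theorem exists_finite_code (hW : IsSupertransitive W) (A : Finset W) :
    ∃ t : W, (∀ y, y ∈ (t : ZFSet.{u}) ↔ ∃ a ∈ A, y = (a : ZFSet.{u})) ∧
      ∀ b, E b (j t) ↔ ∃ a ∈ A, b = j a := by
  classical
  induction A using Finset.induction_on with
  | empty =>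
    refine ⟨⟨∅, hW.empty_mem⟩, by simp, fun b => ?_⟩
    have : (∀' ∼(memF &1 &0) : LMem.BoundedFormula Empty 1).Realize default
        ![j ⟨∅, hW.empty_mem⟩] := by
      rw [realize_standard₁]
      simp [realize_memF, E_iff]
    have h := BoundedFormula.realize_not.1 (BoundedFormula.realize_all.1 this b)
    rw [realize_memF] at h
    simpa using h
  | insert a A _ ih =>
    obtain ⟨s, hs₁, hs₂⟩ := ih
    refine ⟨⟨insert (a : ZFSet.{u}) (s : ZFSet.{u}), hW.insert_mem _ a.2 _ s.2⟩, fun y => ?_,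
      fun b => ?_⟩
    · simp [hs₁]
    · rw [E_insert_standard j _ a s rfl, hs₂]
      simp

variable (hW : IsSupertransitive W)
  (hj : ∀ {n : ℕ} (φ : LMem.BoundedFormula (Fin n) 2) (p : Fin n → M) (S : Set W),
    (∀ A : Finset W, (A : Set W) ⊆ S → ∃ x, ∀ a ∈ A, φ.Realize p ![x, j a]) →
      ∃ x, ∀ a ∈ S, φ.Realize p ![x, j a])

include hW hj

/-- From left to right this is the saturation `hj`, with finite families of standard sets coded by
standard finite sets. The converse holds because a standard finite set has only standard elements.
-/
theorem realize_idealization {n : ℕ} (φ : LMem.BoundedFormula (Fin n) 2) :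
    letI := stStructure (Set.range j)
    M ⊨ idealization φ := by
  let := stStructure (Set.range j)
  rw [idealization, realize_univClosure]
  intro p
  simp only [Formula.Realize, BoundedFormula.realize_all, BoundedFormula.realize_iff,
    BoundedFormula.realize_imp, realize_allSt, BoundedFormula.realize_ex, realize_internal,
    realize_ren₂, realize_memS]
  have h₁ (x : M) : (Fin.snoc default x : Fin (0 + 1) → M) = ![x] := by
    funext i; fin_cases i; rfl
  have h₂ (x a : M) : (Fin.snoc ![x] a : Fin (0 + 1 + 1) → M) = ![x, a] := by
    funext i; fin_cases i <;> rfl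
  simp only [h₁, h₂, realize_finiteF]
  change (∀ A ∈ Set.range j, IsFin A → ∃ x, ∀ a, E a A → φ.Realize p ![x, a]) ↔
    ∃ x, ∀ a ∈ Set.range j, φ.Realize p ![x, a]
  constructor
  · intro h
    suffices h' : ∃ x, ∀ a ∈ Set.univ, φ.Realize p ![x, j a] by
      obtain ⟨x, hx⟩ := h'
      exact ⟨x, by rintro _ ⟨a, rfl⟩; exact hx a trivial⟩
    refine hj φ p Set.univ fun A _ => ?_
    obtain ⟨t, ht₁, ht₂⟩ := exists_finite_code j hW A
    obtain ⟨x, hx⟩ := h (j t) ⟨t, rfl⟩ <| (isFin_standard j t).2 <| isFin_iff.2 <| by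
      refine (A.finite_toSet.image Subtype.val).subset fun y hy => ?_
      obtain ⟨a, ha, rfl⟩ := (ht₁ y).1 hy
      exact ⟨a, ha, rfl⟩
    exact ⟨x, fun a ha => hx _ ((ht₂ _).2 ⟨a, ha, rfl⟩)⟩
  · rintro ⟨x, hx⟩ _ ⟨t, rfl⟩ ht
    refine ⟨x, fun b hb => hx b ?_⟩
    have hfin := isFin_iff.1 ((isFin_standard j t).1 ht)
    have hfin' : {a : W | (a : ZFSet.{u}) ∈ (t : ZFSet.{u})}.Finite :=
      Set.Finite.preimage Subtype.val_injective.injOn hfin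
    obtain ⟨s, hs₁, hs₂⟩ := exists_finite_code j hW hfin'.toFinset
    -- The code of the family of all elements of `t` is `t` itself, by extensionality; hence the
    -- elements of `j t` in `M` are exactly the images of that family.
    have : s = t := by
      refine Subtype.ext (ZFSet.ext fun y => (hs₁ y).trans ⟨?_, fun hy => ?_⟩)
      · rintro ⟨a, ha, rfl⟩
        exact hfin'.mem_toFinset.1 ha
      · exact ⟨⟨y, hW.mem_of_mem t t.2 y hy⟩, hfin'.mem_toFinset.2 hy, rfl⟩
    obtain ⟨a, -, rfl⟩ := (hs₂ b).1 (this ▸ hb)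
    exact ⟨a, rfl⟩

omit hj in
theorem realize_standardization {n : ℕ} (φ : LSt.BoundedFormula (Fin n) 1) :
    letI := stStructure (Set.range j)
    M ⊨ standardization φ := by
  let := stStructure (Set.range j)
  rw [standardization, realize_univClosure]
  intro p
  simp only [Formula.Realize, BoundedFormula.realize_iff, realize_exSt,
    BoundedFormula.realize_inf, realize_allSt, realize_ren₁, realize_memS]
  rintro _ ⟨X, rfl⟩
  -- Separation in `ZFSet` accepts any predicate of the metatheory, so `φ` may mention standardness
  -- and nonstandard parameters.
  let Y : ZFSet.{u} := ZFSet.sep (fun y => ∃ h : y ∈ W, φ.Realize p ![j ⟨y, h⟩]) X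
  refine ⟨j ⟨Y, hW.mem_of_subset X X.2 Y ZFSet.sep_subset⟩, ⟨_, rfl⟩, ?_⟩
  rintro _ ⟨x, rfl⟩
  change E (j x) (j _) ↔ E (j x) (j X) ∧ φ.Realize p ![j x]
  rw [E_standard, E_standard, ZFSet.mem_sep]
  exact and_congr_right fun _ => ⟨fun ⟨_, h⟩ => h, fun h => ⟨x.2, h⟩⟩

omit hW hj in
theorem realize_transfer {n : ℕ} (φ : LMem.BoundedFormula (Fin n) 1) :
    letI := stStructure (Set.range j)
    M ⊨ transfer φ := by
  let := stStructure (Set.range j)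
  rw [transfer]
  refine (realize_stClosure _ _).2 fun p hp => ?_
  choose q hq using hp
  obtain rfl : (fun i => j (q i)) = p := funext hq
  simp only [Formula.Realize, BoundedFormula.realize_imp, BoundedFormula.realize_ex,
    realize_exSt, realize_internal, snoc_fin_zero]
  intro h
  have h₁ : φ.ex.Realize (j ∘ q) (j ∘ default) := by
    refine BoundedFormula.realize_ex.2 ?_
    simp only [snoc_fin_zero]
    exact h
  obtain ⟨x, hx⟩ := BoundedFormula.realize_ex.1 ((j.map_boundedFormula _ _ _).1 h₁)
  refine ⟨j x, ⟨x, rfl⟩, ?_⟩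
  have := (j.map_boundedFormula _ _ _).2 hx
  rwa [snoc_fin_zero] at this

omit hW hj in
theorem realize_internal_sentence (σ : LMem.Sentence) :
    letI := stStructure (Set.range j)
    M ⊨ internal σ ↔ ZFSet.{u} ⊨ σ := by
  let := stStructure (Set.range j)
  refine (realize_internal _ _ _ σ).trans ?_
  exact (j.map_sentence σ).symm.trans (W.subtype.map_sentence σ)

theorem realize_IST {σ : LSt.Sentence} (hσ : σ ∈ IST) :
    letI := stStructure (Set.range j)
    M ⊨ σ := by
  let := stStructure (Set.range j)
  cases hσ with
  | zfc σ hσ => exact (realize_internal_sentence j σ).2 (realize_ZFC hσ)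
  | idealization φ => exact realize_idealization j hW hj φ
  | standardization φ => exact realize_standardization j hW φ
  | transfer φ => exact realize_transfer j φ

/-- The ranks of the `g k` are cofinal in `W`, so no function in `W` takes all these values, while
saturation puts the pairs `(k, g k)` into one function of `M`. -/
theorem not_realize_star (g : ℕ → W)
    (hg : ∀ x ∈ W, ∃ k, ZFSet.rank x ≤ ZFSet.rank (g k : ZFSet.{u})) :
    letI := stStructure (Set.range j)
    ¬ M ⊨ star := by
  let := stStructure (Set.range j)
  let N (k : ℕ) : W := ⟨num k, hW.num_mem k⟩
  let P (k : ℕ) : W := ⟨ZFSet.pair (num k) (g k), hW.pair_mem (hW.num_mem k) (g k).2⟩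
  let φ : LMem.BoundedFormula (Fin 0) 2 := ren ![0] funOnOmegaF ⊓ memF &1 &0
  have hφ (x a : M) : φ.Realize default ![x, a] ↔ IsFunOnOmega x ∧ E a x := by
    simp [φ, realize_ren₁, realize_funOnOmegaF, realize_memF]
  have key : ∃ F : M, IsFunOnOmega F ∧ ∀ k, E (j (P k)) F := by
    suffices h : ∃ x, ∀ a ∈ Set.range P, φ.Realize default ![x, j a] by
      obtain ⟨F, hF⟩ := h
      exact ⟨F, ((hφ _ _).1 (hF (P 0) ⟨0, rfl⟩)).1, fun k => ((hφ _ _).1 (hF (P k) ⟨k, rfl⟩)).2⟩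
    refine hj φ default (Set.range P) fun A hA => ?_
    obtain ⟨t, ht₁, ht₂⟩ := exists_finite_code j hW A
    -- Finite satisfiability for the pairs in `A` is the single property of their code `t` that some
    -- function on `ω` includes it.
    let ψ : LMem.BoundedFormula Empty 1 :=
      ∃' (ren ![1] funOnOmegaF ⊓ ∀' (memF &2 &0 ⟹ memF &2 &1))
    have hψ {M' : Type _} [LMem.Structure M'] (t : M') : ψ.Realize default ![t] ↔
        ∃ x, IsFunOnOmega x ∧ ∀ a, E a t → E a x := by
      simp [ψ, realize_ren₁, realize_funOnOmegaF, realize_memF]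
    have : ψ.Realize default ![j t] := by
      rw [realize_standard₁]
      simp only [ψ, BoundedFormula.realize_ex, BoundedFormula.realize_inf, realize_ren₁,
        BoundedFormula.realize_all, BoundedFormula.realize_imp, realize_memF]
      -- The whole sequence is a witness in `ZFSet`. It need not belong to `W`: only the truth of
      -- `ψ` at `t` is transferred.
      refine ⟨ZFSet.range fun k => ZFSet.pair (num k) (g k), ?_, ?_⟩
      · exact (realize_funOnOmegaF _ _).2 (isFunOnOmega_range _)
      · intro a ha
        obtain ⟨b, hb, rfl⟩ := (ht₁ a).1 ha
        obtain ⟨k, rfl⟩ := hA hb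
        exact ZFSet.mem_range_self (f := fun k => ZFSet.pair (num k) (g k : ZFSet.{u})) k
    obtain ⟨x, hx, hxt⟩ := (hψ _).1 this
    exact ⟨x, fun a ha => (hφ _ _).2 ⟨hx, hxt _ ((ht₂ _).2 ⟨a, ha, rfl⟩)⟩⟩
  obtain ⟨F, hF, hP⟩ := key
  have hN (k : ℕ) : IsNat (j (N k)) := (isNat_standard j _).2 (isNat_iff.2 ⟨k, rfl⟩)
  have happ (k : ℕ) : IsApp F (j (N k)) (j (g k)) :=
    ⟨_, hP k, (isPairOf_standard j _ _ _).2 (isPairOf_iff.2 rfl)⟩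
  intro h
  obtain ⟨_, ⟨G, rfl⟩, -, hG⟩ := (realize_star _).1 h F hF (by
    rintro _ ⟨n, rfl⟩ hn
    obtain ⟨k, hk⟩ := isNat_iff.1 ((isNat_standard j n).1 hn)
    obtain rfl : n = N k := Subtype.ext hk
    exact ⟨_, ⟨g k, rfl⟩, happ k⟩)
  -- Choose `k` with the rank of `G` at most that of `g k`. Since `G` contains the pair `(k, g k)`,
  -- the rank of `g k` is also strictly below that of `G`.
  obtain ⟨k, hk⟩ := hg G G.2
  obtain ⟨y, hy, hy'⟩ := hG _ ⟨N k, rfl⟩ (hN k)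
  obtain rfl := hF.app_unique (hN k) hy (happ k)
  have hmem := isApp_iff.1 ((isApp_standard j _ _ _).1 hy')
  have h₁ : ({(N k : ZFSet.{u}), (g k : ZFSet.{u})} : ZFSet.{u}) ∈
      ZFSet.pair (N k : ZFSet.{u}) (g k) := by simp [ZFSet.pair]
  have h₂ : (g k : ZFSet.{u}) ∈ ({(N k : ZFSet.{u}), (g k : ZFSet.{u})} : ZFSet.{u}) := by simp
  exact (((ZFSet.rank_lt_of_mem h₂).trans (ZFSet.rank_lt_of_mem h₁)).trans
    (ZFSet.rank_lt_of_mem hmem)).not_ge hk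

omit hW hj in
-- The standard natural numbers are the actual ones, so `F` induces an actual sequence of sets. It
-- is a set of the universe, and its image under `j` is the required standard function.
theorem realize_star_of_top (htop : ∀ x, x ∈ W) :
    letI := stStructure (Set.range j)
    M ⊨ star := by
  let := stStructure (Set.range j)
  refine (realize_star _).2 fun F hF h => ?_
  let N (k : ℕ) : W := ⟨num k, htop _⟩
  have hN (k : ℕ) : ∃ y : W, IsApp F (j (N k)) (j y) := by
    obtain ⟨_, ⟨y, rfl⟩, hy⟩ := h _ ⟨N k, rfl⟩ ((isNat_standard j _).2 (isNat_iff.2 ⟨k, rfl⟩))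
    exact ⟨y, hy⟩
  choose g hg using hN
  let G : W := ⟨ZFSet.range fun k => ZFSet.pair (num k) (g k), htop _⟩
  refine ⟨j G, ⟨G, rfl⟩, (isFunOnOmega_standard j G).2 (isFunOnOmega_range _), ?_⟩
  rintro _ ⟨n, rfl⟩ hn
  obtain ⟨k, hk⟩ := isNat_iff.1 ((isNat_standard j n).1 hn)
  obtain rfl : n = N k := Subtype.ext hk
  refine ⟨j (g k), hg k, (isApp_standard j _ _ _).2 (isApp_iff.2 ?_)⟩
  exact ZFSet.mem_range_self (f := fun k => ZFSet.pair (num k) (g k : ZFSet.{u})) k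

end Extension

/-! ### Reflection at an ordinal of countable cofinality -/

section Reflection

open Ordinal

/-- A rank above those of witnesses for all existential statements with parameters of rank
below `o`. -/
theorem exists_witness_bound (o : Ordinal.{u}) : ∃ o' : Ordinal.{u}, o < o' ∧
    ∀ (n : ℕ) (φ : LMem.BoundedFormula Empty (n + 1)) (v : Empty → ZFSet.{u})
      (x : Fin n → ZFSet.{u}), (∀ i, ZFSet.rank (x i) < o) →
      (∃ a, φ.Realize v (Fin.snoc x a : Fin (n + 1) → _)) →
      ∃ a, ZFSet.rank a < o' ∧ φ.Realize v (Fin.snoc x a : Fin (n + 1) → _) := by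
  classical
  let V := {x : ZFSet.{u} // x ∈ ZFSet.vonNeumann o}
  have : Small.{u} V := ZFSet.small_coe _
  let I := Σ n : ℕ, Σ _ : LMem.BoundedFormula Empty (n + 1), Fin n → V
  -- One witness per formula and parameter tuple suffices. The index type is small, so the ranks of
  -- the witnesses have a supremum.
  let w (i : I) : ZFSet.{u} :=
    Classical.epsilon fun a => i.2.1.Realize Empty.elim (Fin.snoc (fun k => (i.2.2 k).1) a)
  refine ⟨max (Order.succ o) (⨆ i, Order.succ (ZFSet.rank (w i))),
    lt_max_of_lt_left (Order.lt_succ o), fun n φ v x hx hφ => ?_⟩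
  obtain rfl : v = Empty.elim := Subsingleton.elim _ _
  let i : I := ⟨n, φ, fun k => ⟨x k, ZFSet.mem_vonNeumann.2 (hx k)⟩⟩
  refine ⟨w i, lt_max_of_lt_right ?_, Classical.epsilon_spec hφ⟩
  exact (Order.lt_succ _).trans_le
    (le_ciSup (f := fun i => Order.succ (ZFSet.rank (w i))) bddAbove_of_small i)

/-- A supertransitive elementary substructure of the universe with ordinals of countable
cofinality. -/
theorem exists_supertransitive_cofinal :
    ∃ W : LMem.ElementarySubstructure ZFSet.{u}, IsSupertransitive W ∧
      ∃ g : ℕ → W, ∀ x ∈ W, ∃ k, ZFSet.rank x ≤ ZFSet.rank (g k : ZFSet.{u}) := by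
  choose s hs hw using exists_witness_bound.{u}
  let o (k : ℕ) : Ordinal.{u} := s^[k] 0
  have ho (k : ℕ) : o (k + 1) = s (o k) := Function.iterate_succ_apply' s k 0
  have hlt (k : ℕ) : o k < o (k + 1) := ho k ▸ hs _
  have hmono : Monotone o := monotone_nat_of_le_succ fun k => (hlt k).le
  let S : LMem.Substructure ZFSet.{u} :=
    { carrier := {x | ∃ k, ZFSet.rank x < o k}
      fun_mem := fun f => Empty.elim f }
  have hS {x : ZFSet.{u}} : x ∈ S ↔ ∃ k, ZFSet.rank x < o k := Iff.rfl
  -- Tarski–Vaught test: finitely many parameters lie below a single `o k`, so a witness occurs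
  -- below `o (k + 1)`.
  let W : LMem.ElementarySubstructure ZFSet.{u} := S.toElementarySubstructure (by
    intro n φ x a ha
    choose f hf using fun i => hS.1 (x i).2
    obtain ⟨k, hk⟩ := Finite.bddAbove_range f
    obtain ⟨b, hb, hφ⟩ := hw (o k) n φ _ (fun i => x i)
      (fun i => (hf i).trans_le (hmono (hk ⟨i, rfl⟩))) ⟨a, ha⟩
    exact ⟨⟨b, hS.2 ⟨k + 1, (ho k).symm ▸ hb⟩⟩, hφ⟩)
  have hW {x : ZFSet.{u}} : x ∈ W ↔ ∃ k, ZFSet.rank x < o k := Iff.rfl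
  refine ⟨W, ⟨fun x hx y hy => ?_, fun x hx y hy => ?_, fun x hx y hy => ?_⟩,
    fun k => ⟨ZFSet.vonNeumann (o k), hW.2 ⟨k + 1, ?_⟩⟩, fun x hx => ?_⟩
  · obtain ⟨k, hk⟩ := hW.1 hx
    exact hW.2 ⟨k, (ZFSet.rank_lt_of_mem hy).trans hk⟩
  · obtain ⟨k, hk⟩ := hW.1 hx
    exact hW.2 ⟨k, (ZFSet.rank_mono hy).trans_lt hk⟩
  · obtain ⟨k, hk⟩ := hW.1 hx
    obtain ⟨l, hl⟩ := hW.1 hy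
    refine hW.2 ⟨max k l + 1, ?_⟩
    rw [ZFSet.rank_insert]
    refine lt_of_le_of_lt (max_le (Order.succ_le_of_lt ?_) ?_) (hlt _)
    · exact hk.trans_le (hmono (le_max_left k l))
    · exact hl.le.trans (hmono (le_max_right k l))
  · rw [ZFSet.rank_vonNeumann]
    exact hlt k
  · obtain ⟨k, hk⟩ := hW.1 hx
    exact ⟨k, by rw [ZFSet.rank_vonNeumann]; exact hk.le⟩

theorem isSupertransitive_top : IsSupertransitive (⊤ : LMem.ElementarySubstructure ZFSet.{u}) :=
  ⟨fun _ _ _ _ => trivial, fun _ _ _ _ => trivial, fun _ _ _ _ => trivial⟩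

end Reflection

/-- The saturated extensions of the whole universe and of a supertransitive elementary substructure
of countable cofinality are models of internal set theory with the same true `∈`-sentences, and
`star` holds in the first one only. -/
theorem not_isTheorem_iff_star (Φ : LMem.Sentence) : ¬ IsTheorem IST (internal Φ ⇔ star) := by
  intro h
  -- The truth value of `Φ` is taken in `ZFSet`, so it does not depend on `W`, and the assumed
  -- theorem forces the same on `star`.
  have key (W : LMem.ElementarySubstructure ZFSet.{0}) (hW : IsSupertransitive W) :
      letI := stStructure (Set.range (limitEmbedding LMem W))
      ZFSet.{0} ⊨ Φ ↔ LimitPower LMem W ⊨ star := by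
    let := stStructure (Set.range (limitEmbedding LMem W))
    have : Nonempty (LimitPower LMem W) := Nonempty.map (limitEmbedding LMem W) inferInstance
    have h₁ : LimitPower LMem W ⊨ (internal Φ ⇔ star) :=
      h.realize fun τ hτ => realize_IST _ hW exists_realize_limitPower hτ
    exact (realize_internal_sentence (limitEmbedding LMem W) Φ).symm.trans
      ((Sentence.realize_iff _).1 h₁)
  obtain ⟨W, hW, g, hg⟩ := exists_supertransitive_cofinal.{0}
  exact not_realize_star _ hW exists_realize_limitPower g hg <| (key W hW).1 <|
    (key ⊤ isSupertransitive_top).2 <| realize_star_of_top _ ElementarySubstructure.mem_top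

end InternalSetTheory


theorem theorem1 (hIST : InternalSetTheory.IsConsistent InternalSetTheory.IST) :
    (∀ Φ : InternalSetTheory.LMem.Sentence,
      ¬ InternalSetTheory.IsTheorem InternalSetTheory.IST
        (InternalSetTheory.internal Φ ⇔ InternalSetTheory.star)) ∧
    ¬ ∃ R : InternalSetTheory.LSt.Sentence → InternalSetTheory.LMem.Sentence,
      ∀ σ : InternalSetTheory.LSt.Sentence,
        InternalSetTheory.IsTheorem InternalSetTheory.IST
          (InternalSetTheory.internal (R σ) ⇔ σ) :=
  ⟨InternalSetTheory.not_isTheorem_iff_star,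
    fun ⟨_, hR⟩ => InternalSetTheory.not_isTheorem_iff_star _ (hR InternalSetTheory.star)⟩
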